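/- Let $A$ be an $N\times N$ and $B$ an $M\times M$ matrix with entries in $\{0,1\}$, where $N,M>1$, both irreducible and satisfying condition (I) of Cuntz and Krieger (from every vertex there is a path to a vertex at which there are two different first-return loops). Let $X_A=\{(x_n)_{n\in\mathbb N}\mid A(x_n,x_{n+1})=1 \text{ for all } n\}$ be the one-sided shift space with the product topology and $\sigma_A$ its shift, and similarly $(X_B,\sigma_B)$. Suppose that $h:X_A\to X_B$ is a homeomorphism giving a continuous orbit equivalence, that is, that there are continuous functions $k_1,l_1:X_A\to\mathbb Z_{\ge 0}$ and $k_2,l_2:X_B\to\mathbb Z_{\ge 0}$ with $$\sigma_B^{k_1(x)}(h(\sigma_A(x)))=\sigma_B^{l_1(x)}(h(x))\ (x\in X_A),\qquad \sigma_A^{k_2(y)}(h^{-1}(\sigma_B(y)))=\sigma_A^{l_2(y)}(h^{-1}(y))\ (y\in X_B).$$ Put $c_1=l_1-k_1$ and $c_2=l_2-k_2$. Let $H^A=C(X_A,\mathbb Z)/\{\xi-\xi\circ\sigma_A\mid \xi\in C(X_A,\mathbb Z)\}$, write $[f]$ for the class of $f$ in it, and similarly for $H^B$. For a continuous function $f$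 on $X_B$ and a continuous function $g$ on $X_A$, integer-valued or complex-valued, let $$\Psi_h(f)(x)=\sum_{i=0}^{l_1(x)-1}f(\sigma_B^i(h(x)))-\sum_{j=0}^{k_1(x)-1}f(\sigma_B^j(h(\sigma_A(x)))),\qquad x\in X_A,$$ $$\Psi_{h^{-1}}(g)(y)=\sum_{i=0}^{l_2(y)-1}g(\sigma_A^i(h^{-1}(y)))-\sum_{j=0}^{k_2(y)-1}g(\sigma_A^j(h^{-1}(\sigma_B(y)))),\qquad y\in X_B.$$ Then $\Psi_h:C(X_B,\mathbb Z)\to C(X_A,\mathbb Z)$ and $\Psi_{h^{-1}}:C(X_A,\mathbb Z)\to C(X_B,\mathbb Z)$ are mutually inverse group isomorphisms, and they extend, by the same formulas, to continuous linear maps $\Psi_h:C(X_B,\mathbb C)\to C(X_A,\mathbb C)$ and $\Psi_{h^{-1}}:C(X_A,\mathbb C)\to C(X_B,\mathbb C)$ between Banach spaces (with the sup norms), which are inverses of each other, such that: 1. For every finite $\sigma_A$-invariant positive regular Borel measure $\mu$ on $X_A$ there is a finite $\sigma_B$-invariant positive regular Borel measure $\nu$ on $X_B$ with $\int f\,d\nu=\int\Psi_h(f)\,d\mu$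 for all $f\in C(X_B,\mathbb C)$, and $\nu$ is the only finite Borel measure with this property. Likewise, for every finite $\sigma_B$-invariant positive regular Borel measure $\mu$ on $X_B$ there is a finite $\sigma_A$-invariant positive regular Borel measure $\nu$ on $X_A$ with $\int g\,d\nu=\int\Psi_{h^{-1}}(g)\,d\mu$ for all $g\in C(X_A,\mathbb C)$, and it is the only finite Borel measure with this property. 2. If $[c_1]=[1]$ in $H^A$ and $\mu$ in the first part of (1) is a probability measure, then so is $\nu$. If $[c_2]=[1]$ in $H^B$ and $\mu$ in the second part of (1) is a probability measure, then so is $\nu$. -/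

import Mathlib

open MeasureTheory

/-- The one-sided shift space of the matrix `A`: all sequences of symbols (indexed from `0`)
whose consecutive symbols are joined by an edge of `A`. -/
def ShiftSpace {N : ℕ} (A : Matrix (Fin N) (Fin N) ℤ) : Type :=
  {x : ℕ → Fin N // ∀ n, A (x n) (x (n + 1)) = 1}

namespace ShiftSpace

variable {N : ℕ} (A : Matrix (Fin N) (Fin N) ℤ)

/-- The topology induced by the product topology on sequences of symbols. -/
instance : TopologicalSpace (ShiftSpace A) :=
  inferInstanceAs (TopologicalSpace {x : ℕ → Fin N // ∀ n, A (x n) (x (n + 1)) = 1})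

/-- The shift space is compact, so that `C(ShiftSpace A, ℂ)` is a Banach space for the sup norm
(whose topology is the one Mathlib puts on continuous maps). -/
instance : CompactSpace (ShiftSpace A) := by
  refine isCompact_iff_compactSpace.mp (IsClosed.isCompact ?_)
  have h : {x : ℕ → Fin N | ∀ n, A (x n) (x (n + 1)) = 1}
      = ⋂ n, {x | A (x n) (x (n + 1)) = 1} := by
    ext x; simp
  change IsClosed {x : ℕ → Fin N | ∀ n, A (x n) (x (n + 1)) = 1}
  rw [h]
  refine isClosed_iInter fun n => ?_
  have hc : Continuous fun x : ℕ → Fin N => (x n, x (n + 1)) := by fun_prop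
  exact (isClosed_discrete {p : Fin N × Fin N | A p.1 p.2 = 1}).preimage hc

/-- The Borel sigma-algebra. -/
instance : MeasurableSpace (ShiftSpace A) := borel _

instance : BorelSpace (ShiftSpace A) := ⟨rfl⟩

/-- The shift transformation. -/
def shift : C(ShiftSpace A, ShiftSpace A) where
  toFun x := ⟨fun n => x.1 (n + 1), fun n => x.2 (n + 1)⟩
  continuous_toFun := by
    refine Continuous.subtype_mk (continuous_pi fun n => ?_) _
    exact (continuous_apply (n + 1)).comp continuous_subtype_val

/-- Finite `shift`-invariant regular positive Borel measures. -/
def invariantMeasures : Set (Measure (ShiftSpace A)) :=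
  {μ | IsFiniteMeasure μ ∧ μ.Regular ∧ MeasurePreserving (shift A) μ μ}

/-- `shift`-invariant regular Borel probability measures. -/
def invariantProbabilityMeasures : Set (Measure (ShiftSpace A)) :=
  {μ | μ ∈ invariantMeasures A ∧ IsProbabilityMeasure μ}

/-- The subgroup of coboundaries `ξ - ξ ∘ shift` with `ξ` a continuous integer function. -/
def coboundaries : AddSubgroup C(ShiftSpace A, ℤ) where
  carrier := {f | ∃ ξ : C(ShiftSpace A, ℤ), f = ξ - ξ.comp (shift A)}
  zero_mem' := ⟨0, by ext x; simp⟩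
  add_mem' := by
    rintro _ _ ⟨ξ, rfl⟩ ⟨η, rfl⟩
    exact ⟨ξ + η, by ext x; simp; ring⟩
  neg_mem' := by
    rintro _ ⟨ξ, rfl⟩
    exact ⟨-ξ, by ext x; simp; ring⟩

/-- The cohomology group of the one-sided shift: continuous integer functions modulo
coboundaries. -/
abbrev Cohomology : Type := C(ShiftSpace A, ℤ) ⧸ coboundaries A

variable {A} in
/-- The class of a continuous integer function in the cohomology group. -/
def cohomologyClass (f : C(ShiftSpace A, ℤ)) : Cohomology A := QuotientAddGroup.mk f

end ShiftSpace

/-- `l` lists the interior vertices of a first-return loop at the vertex `i`: the word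
`i, l, i` is admissible and `i` does not occur in `l` (which may be empty). -/
def IsFirstReturnLoop {N : ℕ} (A : Matrix (Fin N) (Fin N) ℤ) (i : Fin N)
    (l : List (Fin N)) : Prop :=
  List.IsChain (fun a b => A a b = 1) (i :: l ++ [i]) ∧ i ∉ l

/-- Condition (I) of Cuntz and Krieger: every vertex leads (by a path of length at least `0`) to
a vertex at which there are two different first-return loops. -/
def ConditionI {N : ℕ} (A : Matrix (Fin N) (Fin N) ℤ) : Prop :=
  ∀ i, ∃ j, Relation.ReflTransGen (fun a b => A a b = 1) i j ∧
    ∃ l l' : List (Fin N), l ≠ l' ∧ IsFirstReturnLoop A j l ∧ IsFirstReturnLoop A j l'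

/-- A continuous orbit equivalence between two one-sided topological Markov shifts: a
homeomorphism together with continuous functions to the nonnegative integers that witness it.
(The two identities imply that the homeomorphism carries orbits onto orbits.) -/
structure ContinuousOrbitEquiv {N M : ℕ} (A : Matrix (Fin N) (Fin N) ℤ)
    (B : Matrix (Fin M) (Fin M) ℤ) where
  /-- the homeomorphism -/
  h : ShiftSpace A ≃ₜ ShiftSpace B
  k₁ : C(ShiftSpace A, ℕ)
  l₁ : C(ShiftSpace A, ℕ)
  k₂ : C(ShiftSpace B, ℕ)
  l₂ : C(ShiftSpace B, ℕ)
  orbit_eq₁ : ∀ x, (ShiftSpace.shift B)^[k₁ x] (h (ShiftSpace.shift A x))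
    = (ShiftSpace.shift B)^[l₁ x] (h x)
  orbit_eq₂ : ∀ y, (ShiftSpace.shift A)^[k₂ y] (h.symm (ShiftSpace.shift B y))
    = (ShiftSpace.shift A)^[l₂ y] (h.symm y)

namespace ContinuousOrbitEquiv

variable {N M : ℕ} {A : Matrix (Fin N) (Fin N) ℤ} {B : Matrix (Fin M) (Fin M) ℤ}

/-- The same equivalence read backwards, through the inverse homeomorphism. -/
def symm (e : ContinuousOrbitEquiv A B) : ContinuousOrbitEquiv B A where
  h := e.h.symm
  k₁ := e.k₂
  l₁ := e.l₂
  k₂ := e.k₁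
  l₂ := e.l₁
  orbit_eq₁ := e.orbit_eq₂
  orbit_eq₂ := e.orbit_eq₁

/-- The cocycle function `l₁ - k₁` of the homeomorphism (an integer-valued function). For
`e.symm` it is the cocycle function `l₂ - k₂` of the inverse homeomorphism. -/
def cocycle (e : ContinuousOrbitEquiv A B) : C(ShiftSpace A, ℤ) where
  toFun x := (e.l₁ x : ℤ) - (e.k₁ x : ℤ)
  continuous_toFun :=
    (continuous_of_discreteTopology.comp e.l₁.continuous).sub
      (continuous_of_discreteTopology.comp e.k₁.continuous)

theorem continuous_sum_orbit {R : Type} [AddCommGroup R] [TopologicalSpace R]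
    [IsTopologicalAddGroup R] (f : C(ShiftSpace B, R)) {n : ShiftSpace A → ℕ}
    (hn : Continuous n) {u : ShiftSpace A → ShiftSpace B} (hu : Continuous u) :
    Continuous fun x => ∑ i ∈ Finset.range (n x), f ((ShiftSpace.shift B)^[i] (u x)) := by
  have h : Continuous fun p : ℕ × ShiftSpace B =>
      ∑ i ∈ Finset.range p.1, f ((ShiftSpace.shift B)^[i] p.2) := by
    refine continuous_prod_of_discrete_left.mpr fun m => ?_
    refine continuous_finsetSum (Finset.range m) fun i _ => ?_
    exact f.continuous.comp ((ShiftSpace.shift B).continuous.iterate i)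
  exact h.comp (hn.prodMk hu)

/-- The map `Ψ_h` on continuous functions with values in `R` (used for `R = ℤ` and `R = ℂ`),
`Ψ_h(f)(x) = ∑_{i < l₁(x)} f(σ^i(h(x))) - ∑_{j < k₁(x)} f(σ^j(h(σ(x))))`.
For `e.symm` it is the map `Ψ_{h⁻¹}`. -/
def psi (R : Type) [AddCommGroup R] [TopologicalSpace R] [IsTopologicalAddGroup R]
    (e : ContinuousOrbitEquiv A B) : C(ShiftSpace B, R) →+ C(ShiftSpace A, R) where
  toFun f :=
    { toFun := fun x =>
        ∑ i ∈ Finset.range (e.l₁ x), f ((ShiftSpace.shift B)^[i] (e.h x))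
          - ∑ j ∈ Finset.range (e.k₁ x),
              f ((ShiftSpace.shift B)^[j] (e.h (ShiftSpace.shift A x)))
      continuous_toFun :=
        (continuous_sum_orbit f e.l₁.continuous e.h.continuous).sub
          (continuous_sum_orbit f e.k₁.continuous
            (e.h.continuous.comp (ShiftSpace.shift A).continuous)) }
  map_zero' := by ext x; simp
  map_add' f g := by
    ext x
    simp only [ContinuousMap.coe_mk, ContinuousMap.add_apply, Finset.sum_add_distrib]
    abel

end ContinuousOrbitEquiv

/-- An integer-valued continuous function, regarded as a complex-valued one. -/
def intToComplex {X : Type} [TopologicalSpace X] (f : C(X, ℤ)) : C(X, ℂ) where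
  toFun x := (f x : ℂ)
  continuous_toFun := continuous_of_discreteTopology.comp f.continuous

/-- The dual of the operator `P`, on measures regarded as functionals, maps `S` into `T`: for every
`μ ∈ S` the functional `f ↦ ∫ P f dμ` is integration against a measure `ν ∈ T`, and `ν` is the only
finite Borel measure that represents it. -/
def DualMapsMeasures {X Y : Type} [TopologicalSpace X] [MeasurableSpace X]
    [TopologicalSpace Y] [MeasurableSpace Y] (P : C(Y, ℂ) →L[ℂ] C(X, ℂ))
    (S : Set (Measure X)) (T : Set (Measure Y)) : Prop :=
  ∀ μ ∈ S, ∃ ν ∈ T, (∀ f : C(Y, ℂ), ∫ y, f y ∂ν = ∫ x, P f x ∂μ) ∧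
    ∀ ν' : Measure Y, IsFiniteMeasure ν' →
      (∀ f : C(Y, ℂ), ∫ y, f y ∂ν' = ∫ x, P f x ∂μ) → ν' = ν

/-!
Let `σ` be the shift. The maps `Ψ_h` and `Ψ_{h⁻¹}` are understood through the orbit cocycle of a
function `f`: if `σ^L a = σ^K b`, its value at `(a, b)` is the sum of `f` over the first `L`
points of the orbit of `a` minus the sum over the first `K` points of the orbit of `b`. When `a`
is aperiodic the lag `L - K` is determined by `(a, b)`, hence so is this value, and it is additive
along chains `a, b, c` (`OrbitCocycle.trans`, `OrbitCocycle.unique`). By definition `Ψ_h f` at `x`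
is the cocycle of `f` at `(h x, h (σ x))`, so sums of `Ψ_h f` along an orbit segment of `x` are
values of the cocycle of `f` between images of its end points (`birkhoffSum_psi`). Consequently
`Ψ_{h⁻¹} (Ψ_h f) y` is the cocycle of `f` at `(y, σ y)`, that is `f y`, for aperiodic `y`.
Condition (I) excludes isolated points, so aperiodic points are dense by Baire's theorem
(`dense_isAperiodic`), and the identity extends by continuity.

For the measures the point is that `f ↦ ∫ Ψ_h f ∂μ` is a positive functional for every invariant
`μ`, even though `Ψ_h` is not a positive operator. If `σ^p x = x`, the sum of `Ψ_h f` over the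
period is the sum of `f` over `L` points of the orbit of `h x` minus that over `K` points of the
same orbit, where `L` and `K` are the sums of `l₁` and `k₁`. Here `K ≤ L`
(`birkhoffSum_k_le_birkhoffSum_l`): the inverse branch of `σ^p` at `x` contracts a neighbourhood
to `x`, so its conjugate under the homeomorphism `h` cannot expand at `h x`. Thus `f ≥ 0` makes
all periodic sums of `Ψ_h f` nonnegative. This forces a nonnegative integral against every
invariant measure (`integral_nonneg_of_periodic`): up to a uniform error the function depends on
finitely many symbols, and then cutting cycles out of an orbit segment bounds its orbit sums
below, uniformly in the length.

The Riesz–Markov–Kakutani theorem now gives `ν`. It is invariant because `Ψ_h` maps the coboundary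
`f - f ∘ σ` to the coboundary of `f ∘ h` (`psi_sub_comp_shift`), and its mass is `∫ Ψ_h 1 ∂μ`,
where `Ψ_h 1` is the cocycle function `l₁ - k₁` (`psi_one`).
-/

/-! ### Points of the shift space -/

namespace ShiftSpace

variable {N : ℕ} {A : Matrix (Fin N) (Fin N) ℤ}

instance : TopologicalSpace.MetrizableSpace (ShiftSpace A) :=
  Topology.IsEmbedding.subtypeVal.metrizableSpace
    (X := {x : ℕ → Fin N | ∀ n, A (x n) (x (n + 1)) = 1})

@[ext]
theorem ext_symbols {x y : ShiftSpace A} (h : ∀ t, x.1 t = y.1 t) : x = y :=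
  Subtype.ext (funext h)

theorem shift_apply (x : ShiftSpace A) (t : ℕ) : (shift A x).1 t = x.1 (t + 1) := rfl

theorem shift_iterate_apply (n : ℕ) (x : ShiftSpace A) (t : ℕ) :
    ((shift A)^[n] x).1 t = x.1 (t + n) := by
  induction n generalizing x with
  | zero => rfl
  | succ n ih => rw [Function.iterate_succ_apply, ih, shift_apply, add_assoc]

/-- The points that share their first `m` symbols with `x`. -/
def cylinder (x : ShiftSpace A) (m : ℕ) : Set (ShiftSpace A) :=
  {z | ∀ t < m, z.1 t = x.1 t}

theorem isOpen_cylinder (x : ShiftSpace A) (m : ℕ) : IsOpen (cylinder x m) :=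
  (PiNat.isOpen_cylinder (fun _ : ℕ => Fin N) x.1 m).preimage continuous_subtype_val

theorem self_mem_cylinder (x : ShiftSpace A) (m : ℕ) : x ∈ cylinder x m := fun _ _ => rfl

theorem cylinder_anti (x : ShiftSpace A) {m n : ℕ} (h : m ≤ n) :
    cylinder x n ⊆ cylinder x m :=
  fun _ hz t ht => hz t (ht.trans_le h)

theorem cylinder_eq_of_mem {x z : ShiftSpace A} {m : ℕ} (hz : z ∈ cylinder x m) :
    cylinder z m = cylinder x m := by
  ext w
  exact forall₂_congr fun t ht => by rw [hz t ht]

theorem exists_cylinder_subset {x : ShiftSpace A} {U : Set (ShiftSpace A)}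
    (hU : U ∈ nhds x) : ∃ m, cylinder x m ⊆ U := by
  obtain ⟨V, hV, hVU⟩ := (mem_nhds_induced Subtype.val x U).mp hU
  obtain ⟨_, ⟨w, m, rfl⟩, hx, hm⟩ :=
    (PiNat.isTopologicalBasis_cylinders (fun _ : ℕ => Fin N)).mem_nhds_iff.mp hV
  refine ⟨m, fun z hz => hVU (hm ?_)⟩
  intro t ht
  exact (hz t ht).trans (hx t ht)

/-- The sequence that follows `u` up to time `n` and then continues with `v`, which has to start
where `u` has arrived. -/
def splice (u : ShiftSpace A) (n : ℕ) (v : ShiftSpace A) (h : u.1 n = v.1 0) : ShiftSpace A :=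
  ⟨fun t => if t < n then u.1 t else v.1 (t - n), fun t => by
    change A (if t < n then u.1 t else v.1 (t - n))
      (if t + 1 < n then u.1 (t + 1) else v.1 (t + 1 - n)) = 1
    rcases lt_trichotomy (t + 1) n with ht | ht | ht
    · rw [if_pos (by omega), if_pos ht]
      exact u.2 t
    · rw [if_pos (by omega), if_neg (by omega), show t + 1 - n = 0 by omega, ← h, ← ht]
      exact u.2 t
    · rw [if_neg (by omega : ¬t < n), if_neg (by omega : ¬t + 1 < n),
        show t + 1 - n = t - n + 1 by omega]
      exact v.2 _⟩

theorem splice_of_lt {u v : ShiftSpace A} {n : ℕ} (h : u.1 n = v.1 0) {t : ℕ} (ht : t < n) :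
    (splice u n v h).1 t = u.1 t := if_pos ht

theorem splice_add {u v : ShiftSpace A} {n : ℕ} (h : u.1 n = v.1 0) (t : ℕ) :
    (splice u n v h).1 (t + n) = v.1 t := by
  change (if t + n < n then u.1 (t + n) else v.1 (t + n - n)) = v.1 t
  rw [if_neg (by omega), Nat.add_sub_cancel]

theorem shift_iterate_splice {u v : ShiftSpace A} {n : ℕ} (h : u.1 n = v.1 0) :
    (shift A)^[n] (splice u n v h) = v := by
  ext t : 1
  rw [shift_iterate_apply, splice_add]

theorem splice_mem_cylinder {u v : ShiftSpace A} {n m : ℕ} (h : u.1 n = v.1 0)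
    (hv : v ∈ cylinder ((shift A)^[n] u) m) : splice u n v h ∈ cylinder u (n + m) := by
  intro t ht
  rcases lt_or_ge t n with h' | h'
  · exact splice_of_lt h h'
  · obtain ⟨s, rfl⟩ := Nat.exists_eq_add_of_le' h'
    rw [splice_add, hv s (by omega), shift_iterate_apply]

theorem shift_iterate_mem_cylinder {x z : ShiftSpace A} {m s k : ℕ} (hz : z ∈ cylinder x k)
    (h : s + m ≤ k) : (shift A)^[s] z ∈ cylinder ((shift A)^[s] x) m := by
  intro t ht
  rw [shift_iterate_apply, shift_iterate_apply]
  exact hz _ (by omega)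

/-! ### Aperiodic points are dense -/

/-- Prefixing a symbol. -/
def cons (i : Fin N) (x : ShiftSpace A) (h : A i (x.1 0) = 1) : ShiftSpace A :=
  ⟨fun t => Nat.casesOn t i x.1, fun t => by
    cases t with
    | zero => exact h
    | succ t => exact x.2 t⟩

theorem exists_succ_of_conditionI (hA : ConditionI A) (i : Fin N) : ∃ j, A i j = 1 := by
  obtain ⟨j, hij, l, -, -, ⟨hl, -⟩, -⟩ := hA i
  rcases hij.cases_head with rfl | ⟨k, hk, -⟩
  · cases l with
    | nil => simp only [List.cons_append, List.nil_append, List.isChain_cons_cons] at hl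
             exact ⟨_, hl.1⟩
    | cons a l => simp only [List.cons_append, List.isChain_cons_cons] at hl
                  exact ⟨_, hl.1⟩
  · exact ⟨k, hk⟩

theorem exists_point_of_conditionI (hA : ConditionI A) (i : Fin N) :
    ∃ x : ShiftSpace A, x.1 0 = i := by
  choose s hs using exists_succ_of_conditionI hA
  refine ⟨⟨fun t => s^[t] i, fun t => ?_⟩, rfl⟩
  simp only [Function.iterate_succ_apply']
  exact hs _

/-- If no branching is possible after the vertex `j`, there is at most one first-return loop
at `j`. -/
theorem firstReturnLoop_unique {j : Fin N}
    (h : ∀ i, Relation.ReflTransGen (fun a b => A a b = 1) j i →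
      ∀ a b, A i a = 1 → A i b = 1 → a = b)
    {l l' : List (Fin N)} (hl : IsFirstReturnLoop A j l) (hl' : IsFirstReturnLoop A j l') :
    l = l' := by
  have key : ∀ (l l' : List (Fin N)) (i : Fin N),
      Relation.ReflTransGen (fun a b => A a b = 1) j i →
      List.IsChain (fun a b => A a b = 1) (i :: l ++ [j]) →
      List.IsChain (fun a b => A a b = 1) (i :: l' ++ [j]) →
      j ∉ l → j ∉ l' → l = l' := by
    intro l
    induction l with
    | nil =>
      intro l' i hi h1 h2 _ h4
      cases l' with
      | nil => rfl
      | cons b l' =>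
        simp only [List.cons_append, List.nil_append, List.isChain_cons_cons] at h1 h2
        exact absurd (h i hi _ _ h1.1 h2.1) (by rintro rfl; simp at h4)
    | cons a l ih =>
      intro l' i hi h1 h2 h3 h4
      cases l' with
      | nil =>
        simp only [List.cons_append, List.nil_append, List.isChain_cons_cons] at h1 h2
        exact absurd (h i hi _ _ h2.1 h1.1) (by rintro rfl; simp at h3)
      | cons b l' =>
        simp only [List.cons_append, List.isChain_cons_cons] at h1 h2
        obtain rfl := h i hi _ _ h1.1 h2.1
        rw [ih l' a (hi.tail h1.1) h1.2 h2.2 (fun h => h3 (List.mem_cons_of_mem _ h))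
          (fun h => h4 (List.mem_cons_of_mem _ h))]
  exact key l l' j .refl hl.1 hl'.1 hl.2 hl'.2

/-- Under condition (I) a point is never determined by its initial symbol. -/
theorem exists_ne_of_conditionI (hA : ConditionI A) (x : ShiftSpace A) :
    ∃ y : ShiftSpace A, y.1 0 = x.1 0 ∧ y ≠ x := by
  by_contra! hx
  -- Uniqueness of the point with a given initial symbol is inherited along edges.
  have step : ∀ i, Relation.ReflTransGen (fun a b => A a b = 1) (x.1 0) i →
      ∀ y z : ShiftSpace A, y.1 0 = i → z.1 0 = i → y = z := by
    intro i hi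
    induction hi with
    | refl => exact fun y z hy hz => (hx y hy).trans (hx z hz).symm
    | tail _ hab ih =>
      rename_i a b _
      intro y z hy hz
      have := ih (cons a y (hy ▸ hab)) (cons a z (hz ▸ hab)) rfl rfl
      ext t : 1
      exact congrFun (congrArg Subtype.val this) (t + 1)
  obtain ⟨j, hj, l, l', hne, hl, hl'⟩ := hA (x.1 0)
  refine hne (firstReturnLoop_unique (fun i hi a b ha hb => ?_) hl hl')
  obtain ⟨y, hy⟩ := exists_point_of_conditionI hA a
  obtain ⟨z, hz⟩ := exists_point_of_conditionI hA b
  have := step i (hj.trans hi) (cons i y (hy ▸ ha)) (cons i z (hz ▸ hb)) rfl rfl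
  rw [← hy, ← hz]
  exact congrFun (congrArg Subtype.val this) 1

theorem exists_mem_cylinder_ne (hA : ConditionI A) (x : ShiftSpace A) (m : ℕ) :
    ∃ y ∈ cylinder x m, y ≠ x := by
  obtain ⟨v, hv, hne⟩ := exists_ne_of_conditionI hA ((shift A)^[m] x)
  have h : x.1 m = v.1 0 := by rw [hv, shift_iterate_apply, Nat.zero_add]
  refine ⟨splice x m v h, fun t ht => splice_of_lt h ht, fun h' => hne ?_⟩
  rw [← h', shift_iterate_splice]

theorem neBot_nhdsNE (hA : ConditionI A) (x : ShiftSpace A) : (nhdsWithin x {x}ᶜ).NeBot := by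
  rw [← mem_closure_iff_nhdsWithin_neBot, mem_closure_iff_nhds]
  intro U hU
  obtain ⟨m, hm⟩ := exists_cylinder_subset hU
  obtain ⟨y, hy, hne⟩ := exists_mem_cylinder_ne hA x m
  exact ⟨y, hm hy, hne⟩

/-- A point is aperiodic if its forward orbit never repeats, i.e. if it is not even eventually
periodic. -/
def IsAperiodic (x : ShiftSpace A) : Prop :=
  Function.Injective fun n => (shift A)^[n] x

/-- For fixed `m < n` a solution of `σ^m x = σ^n x` is determined by its first `n` symbols. -/
theorem finite_iterate_eq {m n : ℕ} (h : m < n) :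
    {x : ShiftSpace A | (shift A)^[m] x = (shift A)^[n] x}.Finite := by
  refine Set.Finite.of_finite_image (f := fun (x : ShiftSpace A) (i : Fin n) => x.1 i)
    (Set.toFinite _) ?_
  intro x hx y hy hxy
  ext t : 1
  induction t using Nat.strong_induction_on with
  | _ t ih =>
    rcases lt_or_ge t n with ht | ht
    · exact congrFun hxy ⟨t, ht⟩
    · obtain ⟨s, rfl⟩ := Nat.exists_eq_add_of_le' ht
      rw [← shift_iterate_apply, ← shift_iterate_apply, ← hx, ← hy, shift_iterate_apply,
        shift_iterate_apply]
      exact ih _ (by omega)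

theorem dense_isAperiodic (hA : ConditionI A) : Dense {x : ShiftSpace A | IsAperiodic x} := by
  have hfin : ∀ p : {p : ℕ × ℕ // p.1 < p.2},
      {x : ShiftSpace A | (shift A)^[p.1.1] x = (shift A)^[p.1.2] x}.Finite :=
    fun p => finite_iterate_eq p.2
  have key : Dense (⋂ p : {p : ℕ × ℕ // p.1 < p.2},
      {x : ShiftSpace A | (shift A)^[p.1.1] x = (shift A)^[p.1.2] x}ᶜ) := by
    refine dense_iInter_of_isOpen (fun p => (hfin p).isClosed.isOpen_compl) fun p => ?_
    have := fun x : ShiftSpace A => neBot_nhdsNE hA x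
    have h := dense_univ.sdiff_finite (hfin p)
    rwa [← Set.compl_eq_univ_sdiff] at h
  refine key.mono fun x hx => ?_
  rw [Set.mem_iInter] at hx
  intro m n hmn
  rcases lt_trichotomy m n with h | h | h
  · exact absurd hmn (hx ⟨(m, n), h⟩)
  · exact h
  · exact absurd hmn.symm (hx ⟨(n, m), h⟩)

end ShiftSpace

/-! ### The orbit cocycle of a function -/

section OrbitCocycle

variable {X R : Type*} [AddCommGroup R]

/-- The value `s` is obtained for the pair `(a, b)` from some coincidence `T^[L] a = T^[K] b` by
summing `f` along the orbit segment of `a` up to it and subtracting the sum along that of `b`. -/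
def OrbitCocycle (T : X → X) (f : X → R) (a b : X) (s : R) : Prop :=
  ∃ L K, T^[L] a = T^[K] b ∧ s = birkhoffSum T f L a - birkhoffSum T f K b

theorem birkhoffSum_sub_birkhoffSum_add {T : X → X} (f : X → R) {a b : X} {L K : ℕ}
    (h : T^[L] a = T^[K] b) (n : ℕ) :
    birkhoffSum T f (L + n) a - birkhoffSum T f (K + n) b
      = birkhoffSum T f L a - birkhoffSum T f K b := by
  rw [birkhoffSum_add, birkhoffSum_add, h]
  abel

theorem iterate_add_eq {T : X → X} {a b : X} {L K : ℕ} (h : T^[L] a = T^[K] b) (n : ℕ) :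
    T^[L + n] a = T^[K + n] b := by
  rw [add_comm L, add_comm K, Function.iterate_add_apply, Function.iterate_add_apply, h]

/-- Coincidences compose, and the associated differences of sums add up. -/
theorem orbit_coincidence_trans {T : X → X} (f : X → R) {a b c : X} {L K L' K' : ℕ}
    (h : T^[L] a = T^[K] b) (h' : T^[L'] b = T^[K'] c) :
    T^[L + L'] a = T^[K' + K] c ∧
      birkhoffSum T f (L + L') a - birkhoffSum T f (K' + K) c
        = (birkhoffSum T f L a - birkhoffSum T f K b)
          + (birkhoffSum T f L' b - birkhoffSum T f K' c) := by
  constructor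
  · rw [iterate_add_eq h, add_comm K, iterate_add_eq h']
  · rw [← birkhoffSum_sub_birkhoffSum_add f h L', ← birkhoffSum_sub_birkhoffSum_add f h' K,
      add_comm K L']
    abel

namespace OrbitCocycle

variable {T : X → X} {f : X → R} {a b c : X} {s s' : R}

theorem trans (h : OrbitCocycle T f a b s) (h' : OrbitCocycle T f b c s') :
    OrbitCocycle T f a c (s + s') := by
  obtain ⟨L, K, h, rfl⟩ := h
  obtain ⟨L', K', h', rfl⟩ := h'
  obtain ⟨h1, h2⟩ := orbit_coincidence_trans f h h'
  exact ⟨_, _, h1, h2.symm⟩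

theorem symm (h : OrbitCocycle T f a b s) : OrbitCocycle T f b a (-s) := by
  obtain ⟨L, K, h, rfl⟩ := h
  exact ⟨K, L, h.symm, by abel⟩

theorem apply (T : X → X) (f : X → R) (a : X) : OrbitCocycle T f a (T a) (f a) :=
  ⟨1, 0, rfl, by simp⟩

/-- If the orbit of `a` never repeats, two coincidences with `b` have the same lag, so the value
does not depend on the coincidence. -/
theorem unique (ha : Function.Injective fun n => T^[n] a) (h : OrbitCocycle T f a b s)
    (h' : OrbitCocycle T f a b s') : s = s' := by
  obtain ⟨L, K, h, rfl⟩ := h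
  obtain ⟨L', K', h', rfl⟩ := h'
  have hlag : L + K' = L' + K := by
    apply ha
    change T^[L + K'] a = T^[L' + K] a
    rw [iterate_add_eq h, iterate_add_eq h', add_comm]
  rw [← birkhoffSum_sub_birkhoffSum_add f h K', ← birkhoffSum_sub_birkhoffSum_add f h' K, hlag,
    add_comm K]

end OrbitCocycle

end OrbitCocycle

/-! ### The map `psi` -/

namespace ContinuousOrbitEquiv

open ShiftSpace

variable {N M : ℕ} {A : Matrix (Fin N) (Fin N) ℤ} {B : Matrix (Fin M) (Fin M) ℤ}
variable {R : Type} [AddCommGroup R] [TopologicalSpace R] [IsTopologicalAddGroup R]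

theorem psi_apply (e : ContinuousOrbitEquiv A B) (f : C(ShiftSpace B, R)) (x : ShiftSpace A) :
    e.psi R f x = birkhoffSum (shift B) f (e.l₁ x) (e.h x)
      - birkhoffSum (shift B) f (e.k₁ x) (e.h (shift A x)) := rfl

/-- Summing the witnesses along an orbit segment gives the coincidence between the images of its
end points, and the sum of `psi f` is the corresponding difference of sums of `f`. -/
theorem birkhoffSum_psi (e : ContinuousOrbitEquiv A B) (f : C(ShiftSpace B, R)) (n : ℕ)
    (x : ShiftSpace A) :
    (shift B)^[birkhoffSum (shift A) e.l₁ n x] (e.h x)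
        = (shift B)^[birkhoffSum (shift A) e.k₁ n x] (e.h ((shift A)^[n] x)) ∧
      birkhoffSum (shift A) (e.psi R f) n x
        = birkhoffSum (shift B) f (birkhoffSum (shift A) e.l₁ n x) (e.h x)
          - birkhoffSum (shift B) f (birkhoffSum (shift A) e.k₁ n x)
              (e.h ((shift A)^[n] x)) := by
  induction n with
  | zero => simp
  | succ n ih =>
    have h := (e.orbit_eq₁ ((shift A)^[n] x)).symm
    obtain ⟨h1, h2⟩ := orbit_coincidence_trans f ih.1 h
    rw [birkhoffSum_succ, birkhoffSum_succ, birkhoffSum_succ, Function.iterate_succ_apply', ih.2,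
      psi_apply, add_comm (birkhoffSum (shift A) e.k₁ n x)]
    exact ⟨h1, h2.symm⟩

theorem orbitCocycle_psi (e : ContinuousOrbitEquiv A B) (f : C(ShiftSpace B, R)) (n : ℕ)
    (x : ShiftSpace A) :
    OrbitCocycle (shift B) f (e.h x) (e.h ((shift A)^[n] x))
      (birkhoffSum (shift A) (e.psi R f) n x) :=
  ⟨_, _, e.birkhoffSum_psi f n x⟩

/-- `Ψ_{h⁻¹} ∘ Ψ_h = id`. At an aperiodic point `y`, both `f y` and the value of the composition
are the orbit cocycle of `f` between `y` and `σ y`; aperiodic points are dense. -/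
theorem psi_symm_comp_psi [T2Space R] (hB : ConditionI B) (e : ContinuousOrbitEquiv A B) :
    (e.symm.psi R).comp (e.psi R) = AddMonoidHom.id C(ShiftSpace B, R) := by
  ext1 f
  refine DFunLike.coe_injective (Continuous.ext_on (dense_isAperiodic hB)
    (ContinuousMap.continuous _) (ContinuousMap.continuous _) fun y hy => ?_)
  have h1 := e.orbitCocycle_psi f (e.l₂ y) (e.h.symm y)
  have h2 := e.orbitCocycle_psi f (e.k₂ y) (e.h.symm (shift B y))
  rw [e.orbit_eq₂] at h2
  rw [Homeomorph.apply_symm_apply] at h1 h2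
  have h3 := h1.trans h2.symm
  rw [← sub_eq_add_neg] at h3
  exact h3.unique hy (.apply _ _ _)

theorem psi_comp_psi_symm [T2Space R] (hA : ConditionI A) (e : ContinuousOrbitEquiv A B) :
    (e.psi R).comp (e.symm.psi R) = AddMonoidHom.id C(ShiftSpace A, R) :=
  e.symm.psi_symm_comp_psi hA

/-- `psi` carries coboundaries to coboundaries. -/
theorem psi_sub_comp_shift (e : ContinuousOrbitEquiv A B) (f : C(ShiftSpace B, R))
    (x : ShiftSpace A) :
    e.psi R (f - f.comp (shift B)) x = f (e.h x) - f (e.h (shift A x)) := by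
  have key : ∀ (n : ℕ) (y : ShiftSpace B),
      birkhoffSum (shift B) (f - f.comp (shift B) : C(ShiftSpace B, R)) n y
        = f y - f ((shift B)^[n] y) := by
    intro n y
    induction n with
    | zero => simp
    | succ n ih =>
      rw [birkhoffSum_succ, ih, Function.iterate_succ_apply']
      simp
  rw [psi_apply, key, key, e.orbit_eq₁]
  abel

theorem psi_map {S : Type} [AddCommGroup S] [TopologicalSpace S] [IsTopologicalAddGroup S]
    (e : ContinuousOrbitEquiv A B) (φ : R →+ S) {f : C(ShiftSpace B, R)} {g : C(ShiftSpace B, S)}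
    (h : ∀ y, g y = φ (f y)) (x : ShiftSpace A) : e.psi S g x = φ (e.psi R f x) := by
  simp only [psi_apply, birkhoffSum, map_sub, map_sum, h]

/-! ### Positivity on periodic orbits -/

/-- Along a periodic orbit the witnesses satisfy `∑ k₁ ≤ ∑ l₁`. The inverse branch of `σ^p` at a
periodic point `x` is contracting; if `∑ l₁ < ∑ k₁`, its conjugate by `h` would expand near
`h x`, while its iterates converge to `h x`. -/
theorem birkhoffSum_k_le_birkhoffSum_l (hA : ConditionI A) (e : ContinuousOrbitEquiv A B)
    {x : ShiftSpace A} {p : ℕ} (hp : 0 < p) (hx : (shift A)^[p] x = x) :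
    birkhoffSum (shift A) e.k₁ p x ≤ birkhoffSum (shift A) e.l₁ p x := by
  by_contra! hlt
  have hcont : ∀ g : C(ShiftSpace A, ℕ), Continuous (birkhoffSum (shift A) g p) := fun g =>
    continuous_finsetSum _ fun i _ => g.continuous.comp ((shift A).continuous.iterate i)
  set L := birkhoffSum (shift A) e.l₁ p x
  set K := birkhoffSum (shift A) e.k₁ p x
  -- Near `x` the coincidence of `h z` and `h (σ^p z)` has the same exponents as at `x`.
  obtain ⟨m, hm⟩ : ∃ m, cylinder x m ⊆ {z | birkhoffSum (shift A) e.l₁ p z = L ∧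
      birkhoffSum (shift A) e.k₁ p z = K} := by
    refine exists_cylinder_subset (Filter.inter_mem ?_ ?_)
    · exact (hcont e.l₁).continuousAt.preimage_mem_nhds ((isOpen_discrete {L}).mem_nhds rfl)
    · exact (hcont e.k₁).continuousAt.preimage_mem_nhds ((isOpen_discrete {K}).mem_nhds rfl)
  have hxp : ∀ r, (shift A)^[p * r] x = x := by
    intro r
    rw [Function.iterate_mul]
    exact Function.iterate_fixed hx r
  -- The points `z r` are the iterates of the inverse branch on a point close to `x`.
  obtain ⟨v, hv, hvne⟩ := exists_mem_cylinder_ne hA x (m + 1)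
  have hsp : ∀ r, x.1 (p * r) = v.1 0 := by
    intro r
    rw [hv 0 (by omega), ← Nat.zero_add (p * r), ← shift_iterate_apply, hxp]
  let z : ℕ → ShiftSpace A := fun r => splice x (p * r) v (hsp r)
  have hz_mem : ∀ r, z r ∈ cylinder x (p * r + (m + 1)) := fun r =>
    splice_mem_cylinder _ (by rwa [hxp])
  have hz_shift : ∀ r, (shift A)^[p] (z (r + 1)) = z r := by
    intro r
    ext t : 1
    rw [shift_iterate_apply]
    rcases lt_or_ge t (p * r) with ht | ht
    · have h1 : t + p < p * (r + 1) := by rw [Nat.mul_succ]; omega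
      rw [splice_of_lt _ h1, splice_of_lt _ ht, ← shift_iterate_apply, hx]
    · obtain ⟨s, rfl⟩ := Nat.exists_eq_add_of_le' ht
      rw [add_assoc, ← Nat.mul_succ, splice_add, splice_add]
  have hrel : ∀ r, (shift B)^[L] (e.h (z (r + 1))) = (shift B)^[K] (e.h (z r)) := by
    intro r
    obtain ⟨h1, h2⟩ := hm (cylinder_anti x (by omega) (hz_mem (r + 1)))
    have := (e.birkhoffSum_psi (0 : C(ShiftSpace B, ℤ)) p (z (r + 1))).1
    rwa [h1, h2, hz_shift] at this
  have hrel0 : (shift B)^[L] (e.h x) = (shift B)^[K] (e.h x) := by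
    have := (e.birkhoffSum_psi (0 : C(ShiftSpace B, ℤ)) p x).1
    rwa [hx] at this
  -- Eventually `h (z r)` agrees with `h x` up to `K`, hence everywhere.
  obtain ⟨m', hm'⟩ : ∃ m', cylinder x m' ⊆ e.h ⁻¹' cylinder (e.h x) K :=
    exists_cylinder_subset (e.h.continuous.continuousAt.preimage_mem_nhds
      ((isOpen_cylinder _ _).mem_nhds (self_mem_cylinder _ _)))
  have hagree : ∀ t r, m' ≤ r → (e.h (z r)).1 t = (e.h x).1 t := by
    intro t
    induction t using Nat.strong_induction_on with
    | _ t ih =>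
      intro r hr
      rcases lt_or_ge t K with ht | ht
      · have hpr : r ≤ p * r := Nat.le_mul_of_pos_left r hp
        exact hm' (cylinder_anti x (by omega) (hz_mem r)) t ht
      · obtain ⟨s, rfl⟩ := Nat.exists_eq_add_of_le' ht
        rw [← shift_iterate_apply, ← shift_iterate_apply, ← hrel, ← hrel0, shift_iterate_apply,
          shift_iterate_apply]
        exact ih _ (by omega) _ (by omega)
  have hzx : z m' = x := e.h.injective (ext_symbols fun t => hagree t m' le_rfl)
  apply hvne
  rw [← shift_iterate_splice (hsp m')]
  exact (congrArg _ hzx).trans (hxp m')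

theorem birkhoffSum_psi_nonneg (hA : ConditionI A) (e : ContinuousOrbitEquiv A B)
    {f : C(ShiftSpace B, ℝ)} (hf : ∀ y, 0 ≤ f y) {x : ShiftSpace A} {p : ℕ} (hp : 0 < p)
    (hx : (shift A)^[p] x = x) : 0 ≤ birkhoffSum (shift A) (e.psi ℝ f) p x := by
  rw [(e.birkhoffSum_psi f p x).2, hx, sub_nonneg]
  exact Finset.sum_le_sum_of_subset_of_nonneg
    (Finset.range_mono (e.birkhoffSum_k_le_birkhoffSum_l hA hp hx)) fun _ _ _ => hf _

end ContinuousOrbitEquiv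

/-! ### Functions with nonnegative sums along periodic orbits -/

namespace ShiftSpace

variable {N : ℕ} {A : Matrix (Fin N) (Fin N) ℤ}

/-- If the block of length `m + 1` at time `i` recurs at time `i + d`, then the orbit segment from
`i` to `i + d` is followed, up to `m + 1` symbols, by that of a point of period `d`. -/
theorem exists_periodic_of_recurrence {x : ShiftSpace A} {i d m : ℕ} (hd : 0 < d)
    (h : (shift A)^[i + d] x ∈ cylinder ((shift A)^[i] x) (m + 1)) :
    ∃ q : ShiftSpace A, (shift A)^[d] q = q ∧ q ∈ cylinder ((shift A)^[i] x) (d + (m + 1)) := by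
  have hrec : ∀ t < m + 1, x.1 (t + (i + d)) = x.1 (t + i) := fun t ht => by
    rw [← shift_iterate_apply, h t ht, shift_iterate_apply]
  have hadm : ∀ t, A (x.1 (t % d + i)) (x.1 ((t + 1) % d + i)) = 1 := by
    intro t
    have hlt := Nat.mod_lt t hd
    rcases Nat.lt_or_ge (t % d + 1) d with h1 | h1
    · rw [Nat.add_mod, Nat.mod_eq_of_lt (a := 1) (by omega), Nat.mod_eq_of_lt h1,
        Nat.add_right_comm]
      exact x.2 _
    · have h2 : t % d + 1 = d := by omega
      have h3 : (t + 1) % d = 0 := by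
        rw [← Nat.mod_add_mod, h2, Nat.mod_self]
      rw [h3, ← hrec 0 (by omega), show 0 + (i + d) = t % d + i + 1 by omega]
      exact x.2 _
  refine ⟨⟨fun t => x.1 (t % d + i), hadm⟩, ?_, ?_⟩
  · ext t : 1
    refine (shift_iterate_apply d _ t).trans ?_
    change x.1 ((t + d) % d + i) = x.1 (t % d + i)
    rw [Nat.add_mod_right]
  · intro t
    rw [shift_iterate_apply]
    change t < d + (m + 1) → x.1 (t % d + i) = x.1 (t + i)
    induction t using Nat.strong_induction_on with
    | _ t ih =>
      intro ht
      rcases Nat.lt_or_ge t d with h1 | h1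
      · rw [Nat.mod_eq_of_lt h1]
      · obtain ⟨s, rfl⟩ := Nat.exists_eq_add_of_le' h1
        rw [Nat.add_mod_right, ih s (by omega) (by omega), ← hrec s (by omega),
          add_assoc s, add_comm d]

/-- Let `G` depend on the first `m + 1` symbols only. If its sums along periodic orbits are
nonnegative, then all its orbit sums are bounded below: cycles can be cut out of a long orbit
segment without increasing the sum, until no block of length `m + 1` is repeated. -/
theorem neg_le_birkhoffSum_of_periodic {G : ShiftSpace A → ℝ} {m : ℕ} {c : ℝ} (hc : 0 ≤ c)
    (hGm : ∀ x, ∀ z ∈ cylinder x (m + 1), G z = G x) (hGc : ∀ x, -c ≤ G x)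
    (hper : ∀ (p : ℕ) (x : ShiftSpace A), 0 < p → (shift A)^[p] x = x →
      0 ≤ birkhoffSum (shift A) G p x) (n : ℕ) (x : ShiftSpace A) :
    -(Fintype.card (Fin (m + 1) → Fin N) * c) ≤ birkhoffSum (shift A) G n x := by
  induction n using Nat.strong_induction_on generalizing x with
  | _ n ih =>
  rcases le_or_gt n (Fintype.card (Fin (m + 1) → Fin N)) with hn | hn
  · calc -(Fintype.card (Fin (m + 1) → Fin N) * c) ≤ -(n * c) := by
          gcongr
      _ = ∑ _i ∈ Finset.range n, -c := by simp
      _ ≤ _ := Finset.sum_le_sum fun i _ => hGc _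
  -- Two equal blocks among the first `n` ones.
  have hcard : Fintype.card (Fin (m + 1) → Fin N) < Fintype.card (Fin n) := by
    rwa [Fintype.card_fin]
  obtain ⟨i, j, hne, hij⟩ := Fintype.exists_ne_map_eq_of_card_lt
    (fun (i : Fin n) (t : Fin (m + 1)) => x.1 (t + i)) hcard
  wlog hlt : (i : ℕ) < j generalizing i j
  · exact this j i hne.symm hij.symm (by omega)
  obtain ⟨d, hd⟩ := Nat.exists_eq_add_of_le hlt.le
  obtain ⟨k, hk⟩ := Nat.exists_eq_add_of_le j.2.le
  have hmem : (shift A)^[i + d] x ∈ cylinder ((shift A)^[i] x) (m + 1) := by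
    intro t ht
    rw [shift_iterate_apply, shift_iterate_apply, ← hd]
    exact (congrFun hij ⟨t, ht⟩).symm
  obtain ⟨q, hq, hqm⟩ := exists_periodic_of_recurrence (by omega) hmem
  have hsp : x.1 i = ((shift A)^[i + d] x).1 0 := by
    rw [hmem 0 (by omega), shift_iterate_apply, Nat.zero_add]
  set x' := splice x i ((shift A)^[i + d] x) hsp with hx'
  have h1 : birkhoffSum (shift A) G i x' = birkhoffSum (shift A) G i x :=
    Finset.sum_congr rfl fun s hs => hGm _ _ <| shift_iterate_mem_cylinder
      (splice_mem_cylinder hsp hmem) (by rw [Finset.mem_range] at hs; omega)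
  have h2 : birkhoffSum (shift A) G d q = birkhoffSum (shift A) G d ((shift A)^[i] x) :=
    Finset.sum_congr rfl fun s hs => hGm _ _ <| shift_iterate_mem_cylinder hqm
      (by rw [Finset.mem_range] at hs; omega)
  have h3 : birkhoffSum (shift A) G n x
      = birkhoffSum (shift A) G (i + k) x' + birkhoffSum (shift A) G d q := by
    have hn' : n = i + d + k := by omega
    rw [congrArg (fun a => birkhoffSum (shift A) G a x) hn']
    rw [birkhoffSum_add, birkhoffSum_add, birkhoffSum_add, h1, h2, hx', shift_iterate_splice]
    ring
  rw [h3]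
  have h4 := ih (i + k) (by omega) x'
  have h5 := hper d q (by omega) hq
  linarith

theorem exists_uniform_cylinder (g : C(ShiftSpace A, ℝ)) {ε : ℝ} (hε : 0 < ε) :
    ∃ m, ∀ x, ∀ z ∈ cylinder x m, |g z - g x| < ε := by
  have h : ∀ x, ∃ m, cylinder x m ⊆ g ⁻¹' Metric.ball (g x) (ε / 2) := fun x =>
    exists_cylinder_subset
      (g.continuous.continuousAt.preimage_mem_nhds (Metric.ball_mem_nhds _ (half_pos hε)))
  choose m hm using h
  obtain ⟨t, ht⟩ := CompactSpace.elim_nhds_subcover (fun x => cylinder x (m x)) fun x =>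
    (isOpen_cylinder x _).mem_nhds (self_mem_cylinder x _)
  refine ⟨t.sup m, fun x z hz => ?_⟩
  have hx : x ∈ ⋃ c ∈ t, cylinder c (m c) := by rw [ht]; trivial
  rw [Set.mem_iUnion₂] at hx
  obtain ⟨c, hct, hxc⟩ := hx
  have hzc : z ∈ cylinder c (m c) := fun s hs =>
    (hz s (hs.trans_le (Finset.le_sup hct))).trans (hxc s hs)
  have h1 := hm c hxc
  have h2 := hm c hzc
  rw [Set.mem_preimage, Metric.mem_ball, Real.dist_eq, abs_lt] at h1 h2
  rw [abs_lt]
  constructor <;> linarith [h1.1, h1.2, h2.1, h2.2]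

/-- A continuous function is uniformly close to one that depends on finitely many symbols. -/
theorem exists_locallyConstant_near (g : C(ShiftSpace A, ℝ)) {ε : ℝ} (hε : 0 < ε) :
    ∃ (m : ℕ) (G : ShiftSpace A → ℝ), (∀ x, ∀ z ∈ cylinder x (m + 1), G z = G x) ∧
      ∀ x, |G x - g x| < ε := by
  obtain ⟨m, hm⟩ := exists_uniform_cylinder g hε
  -- `G` evaluates `g` at a point chosen from each cylinder.
  refine ⟨m, fun x => g (Set.Nonempty.some ⟨x, self_mem_cylinder x (m + 1)⟩),
    fun x z hz => ?_, fun x => ?_⟩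
  · simp only [cylinder_eq_of_mem hz]
  · exact hm x _ (cylinder_anti x (Nat.le_succ m) (Set.Nonempty.some_mem _))

theorem integral_birkhoffSum {μ : Measure (ShiftSpace A)} [IsFiniteMeasure μ]
    (hμ : MeasurePreserving (shift A) μ μ) (g : C(ShiftSpace A, ℝ)) (n : ℕ) :
    ∫ x, birkhoffSum (shift A) g n x ∂μ = n * ∫ x, g x ∂μ := by
  have hc : ∀ k, Continuous fun x => g ((shift A)^[k] x) := fun k =>
    g.continuous.comp ((shift A).continuous.iterate k)
  unfold birkhoffSum
  rw [integral_finsetSum _ fun k _ => (hc k).integrable_of_hasCompactSupport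
    (HasCompactSupport.of_compactSpace _)]
  have : ∀ k, ∫ x, g ((shift A)^[k] x) ∂μ = ∫ x, g x ∂μ := fun k => by
    have hk := hμ.iterate k
    conv_rhs => rw [← hk.map_eq]
    exact (integral_map hk.measurable.aemeasurable
      g.continuous.aestronglyMeasurable).symm
  simp [this]

/-- A continuous function whose sums along periodic orbits are nonnegative has nonnegative integral
against every invariant measure. -/
theorem integral_nonneg_of_periodic {μ : Measure (ShiftSpace A)} [IsFiniteMeasure μ]
    (hμ : MeasurePreserving (shift A) μ μ) (g : C(ShiftSpace A, ℝ))
    (hper : ∀ (p : ℕ) (x : ShiftSpace A), 0 < p → (shift A)^[p] x = x →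
      0 ≤ birkhoffSum (shift A) g p x) :
    0 ≤ ∫ x, g x ∂μ := by
  -- It suffices to bound `∫ g` below by `-2 ε μ(X)`; for this `n ∫ g` is compared with the
  -- bounded-below orbit sums of a locally constant function `ε`-close to `g + ε`.
  have key : ∀ ε > 0, -(2 * ε * μ.real Set.univ) ≤ ∫ x, g x ∂μ := by
    intro ε hε
    obtain ⟨m, G, hGm, hG⟩ := exists_locallyConstant_near g hε
    have hsum : ∀ n x, |birkhoffSum (shift A) G n x - birkhoffSum (shift A) g n x| ≤ n * ε := by
      intro n x
      rw [birkhoffSum, birkhoffSum, ← Finset.sum_sub_distrib]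
      refine (Finset.abs_sum_le_sum_abs _ _).trans ?_
      refine (Finset.sum_le_sum fun i _ => (hG _).le).trans ?_
      simp
    have hadd : ∀ n x, birkhoffSum (shift A) (fun z => G z + ε) n x
        = birkhoffSum (shift A) G n x + n * ε := by
      intro n x
      simp [birkhoffSum, Finset.sum_add_distrib]
    have hbound : ∀ x, -‖g‖ ≤ G x + ε := fun x => by
      have h1 := g.norm_coe_le_norm x
      rw [Real.norm_eq_abs] at h1
      linarith [(abs_lt.mp (hG x)).1, (abs_le.mp h1).1]
    obtain ⟨C, hC⟩ : ∃ C : ℝ, ∀ n x, -C ≤ birkhoffSum (shift A) (fun z => G z + ε) n x :=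
      ⟨_, neg_le_birkhoffSum_of_periodic (norm_nonneg g) (fun x z hz => by rw [hGm x z hz])
        hbound fun p x hp hx => by
          rw [hadd]
          linarith [hper p x hp hx, (abs_le.mp (hsum p x)).1]⟩
    have hint : ∀ n : ℕ, (-C - n * (2 * ε)) * μ.real Set.univ ≤ n * ∫ x, g x ∂μ := by
      intro n
      rw [← integral_birkhoffSum hμ, mul_comm, ← smul_eq_mul, ← integral_const]
      refine integral_mono (integrable_const _) ?_ fun x => ?_
      · refine Continuous.integrable_of_hasCompactSupport ?_ (HasCompactSupport.of_compactSpace _)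
        exact continuous_finsetSum _ fun k _ =>
          g.continuous.comp ((shift A).continuous.iterate k)
      · have h1 := hC n x
        rw [hadd] at h1
        change _ ≤ birkhoffSum (shift A) g n x
        linarith [(abs_le.mp (hsum n x)).2]
    -- Divide by `n`, which may be arbitrarily large.
    by_contra! hlt
    obtain ⟨n, hn⟩ := exists_nat_gt
      (C * μ.real Set.univ / (-(2 * ε * μ.real Set.univ) - ∫ x, g x ∂μ))
    rw [div_lt_iff₀ (by linarith)] at hn
    linarith [hint n]
  by_contra! hlt
  have hμ0 : (0 : ℝ) ≤ μ.real Set.univ := measureReal_nonneg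
  have h1 := key (-(∫ x, g x ∂μ) / (4 * (μ.real Set.univ + 1)))
    (div_pos (by linarith) (by linarith))
  have h2 : 2 * (-(∫ x, g x ∂μ) / (4 * (μ.real Set.univ + 1))) * μ.real Set.univ
      ≤ -(∫ x, g x ∂μ) / 2 := by
    rw [mul_div_assoc', div_mul_eq_mul_div, div_le_div_iff₀ (by linarith) (by norm_num)]
    nlinarith
  linarith

end ShiftSpace

/-! ### Measures on compact metrizable spaces as functionals -/

section Functionals

variable {X : Type} [TopologicalSpace X] [MeasurableSpace X] [BorelSpace X]

theorem ContinuousMap.integrable_of_compactSpace [CompactSpace X] {E : Type*}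
    [NormedAddCommGroup E] [SecondCountableTopologyEither X E] (μ : Measure X)
    [IsFiniteMeasure μ] (f : C(X, E)) : Integrable f μ :=
  f.continuous.integrable_of_hasCompactSupport (HasCompactSupport.of_compactSpace _)

theorem measure_ext_of_integral_eq [CompactSpace X] [TopologicalSpace.MetrizableSpace X]
    {μ ν : Measure X} [IsFiniteMeasure μ] [IsFiniteMeasure ν]
    (h : ∀ f : C(X, ℂ), ∫ x, f x ∂μ = ∫ x, f x ∂ν) : μ = ν := by
  have := TopologicalSpace.pseudoMetrizableSpacePseudoMetric X
  refine ext_of_forall_integral_eq_of_IsFiniteMeasure fun f => ?_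
  have h1 := h ⟨fun x => (f x : ℂ), Complex.continuous_ofReal.comp f.continuous⟩
  simp only [ContinuousMap.coe_mk] at h1
  rw [integral_complex_ofReal, integral_complex_ofReal] at h1
  exact_mod_cast h1

end Functionals

/-! ### Transport of invariant measures -/

namespace ContinuousOrbitEquiv

open ShiftSpace

variable {N M : ℕ} {A : Matrix (Fin N) (Fin N) ℤ} {B : Matrix (Fin M) (Fin M) ℤ}

/-- `psi` as a bounded operator between the spaces of continuous complex functions. It is bounded
since the continuous functions `l₁` and `k₁` are bounded. -/
noncomputable def psiCLM (e : ContinuousOrbitEquiv A B) :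
    C(ShiftSpace B, ℂ) →L[ℂ] C(ShiftSpace A, ℂ) :=
  LinearMap.mkContinuousOfExistsBound
    { e.psi ℂ with
      map_smul' := fun c f => ContinuousMap.ext fun x =>
        e.psi_map (AddMonoidHom.mulLeft c) (fun _ => rfl) x }
    (by
      obtain ⟨b, hb⟩ := (isCompact_range (e.l₁ + e.k₁).continuous).bddAbove
      refine ⟨b, fun f => (ContinuousMap.norm_le _ (by positivity)).mpr fun x => ?_⟩
      have hsum : ∀ (n : ℕ) (y : ShiftSpace B), ‖birkhoffSum (shift B) f n y‖ ≤ n * ‖f‖ := by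
        intro n y
        refine (norm_sum_le _ _).trans
          ((Finset.sum_le_sum fun i _ => f.norm_coe_le_norm _).trans ?_)
        simp
      have hx : e.l₁ x + e.k₁ x ≤ b := hb ⟨x, rfl⟩
      calc ‖e.psi ℂ f x‖ ≤ e.l₁ x * ‖f‖ + e.k₁ x * ‖f‖ :=
            (norm_sub_le _ _).trans (add_le_add (hsum _ _) (hsum _ _))
        _ = ((e.l₁ x + e.k₁ x : ℕ) : ℝ) * ‖f‖ := by push_cast; ring
        _ ≤ b * ‖f‖ := by gcongr)

theorem psiCLM_apply (e : ContinuousOrbitEquiv A B) (f : C(ShiftSpace B, ℂ)) :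
    e.psiCLM f = e.psi ℂ f := rfl

theorem psi_intToComplex (e : ContinuousOrbitEquiv A B) (f : C(ShiftSpace B, ℤ)) :
    e.psi ℂ (intToComplex f) = intToComplex (e.psi ℤ f) :=
  ContinuousMap.ext fun x => e.psi_map (Int.castAddHom ℂ) (fun _ => rfl) x

/-- Integration of `psi f` against an invariant measure is a positive functional of `f`, although
`psi f` itself may take negative values for nonnegative `f`. -/
theorem integral_psi_nonneg (hA : ConditionI A) (e : ContinuousOrbitEquiv A B)
    {μ : Measure (ShiftSpace A)} [IsFiniteMeasure μ] (hμ : MeasurePreserving (shift A) μ μ)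
    {f : C(ShiftSpace B, ℝ)} (hf : ∀ y, 0 ≤ f y) : 0 ≤ ∫ x, e.psi ℝ f x ∂μ :=
  integral_nonneg_of_periodic hμ _ fun _ _ hp hx => e.birkhoffSum_psi_nonneg hA hf hp hx

/-- The positive functional `f ↦ ∫ psi f ∂μ`, on the compactly supported functions, which by
compactness are all continuous ones. -/
noncomputable def psiFunctional (hA : ConditionI A) (e : ContinuousOrbitEquiv A B)
    (μ : Measure (ShiftSpace A)) [IsFiniteMeasure μ] (hμ : MeasurePreserving (shift A) μ μ) :
    CompactlySupportedContinuousMap (ShiftSpace B) ℝ →ₚ[ℝ] ℝ :=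
  PositiveLinearMap.mk₀
    { toFun := fun f => ∫ x, e.psi ℝ f.toContinuousMap x ∂μ
      map_add' := fun f g => by
        rw [← integral_add (ContinuousMap.integrable_of_compactSpace _ _)
          (ContinuousMap.integrable_of_compactSpace _ _)]
        exact integral_congr_ae (.of_forall fun x =>
          DFunLike.congr_fun ((e.psi ℝ).map_add f.toContinuousMap g.toContinuousMap) x)
      map_smul' := fun c f => by
        rw [RingHom.id_apply, smul_eq_mul, ← integral_const_mul]
        exact integral_congr_ae (.of_forall fun x =>
          e.psi_map (AddMonoidHom.mulLeft c) (fun _ => rfl) x) }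
    fun _ hf => e.integral_psi_nonneg hA hμ fun y => hf y

theorem integral_coboundary {μ : Measure (ShiftSpace A)} [IsFiniteMeasure μ]
    (hμ : MeasurePreserving (shift A) μ μ) (g : C(ShiftSpace A, ℂ)) :
    ∫ x, (g x - g (shift A x)) ∂μ = 0 := by
  have h : ∫ x, g (shift A x) ∂μ = ∫ x, g x ∂μ := by
    conv_rhs => rw [← hμ.map_eq]
    exact (integral_map hμ.measurable.aemeasurable g.continuous.aestronglyMeasurable).symm
  exact (integral_sub (ContinuousMap.integrable_of_compactSpace μ g)
    (ContinuousMap.integrable_of_compactSpace μ (g.comp (shift A)))).trans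
      (sub_eq_zero.mpr h.symm)

theorem exists_regular_measure_integral_eq (hA : ConditionI A) (e : ContinuousOrbitEquiv A B)
    {μ : Measure (ShiftSpace A)} (hμ : μ ∈ invariantMeasures A) :
    ∃ ν : Measure (ShiftSpace B), IsFiniteMeasure ν ∧ ν.Regular ∧
      ∀ f : C(ShiftSpace B, ℂ), ∫ y, f y ∂ν = ∫ x, e.psi ℂ f x ∂μ := by
  obtain ⟨hfin, -, hinv⟩ := hμ
  let ν := RealRMK.rieszMeasure (e.psiFunctional hA μ hinv)
  have hνfin : IsFiniteMeasure ν := CompactSpace.isFiniteMeasure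
  have hreal : ∀ f : C(ShiftSpace B, ℝ), ∫ y, f y ∂ν = ∫ x, e.psi ℝ f x ∂μ := fun f =>
    RealRMK.integral_rieszMeasure _ (CompactlySupportedContinuousMap.continuousMapEquiv f)
  refine ⟨ν, hνfin, inferInstance, fun f => ?_⟩
  have hre := hreal ⟨fun y => (f y).re, Complex.continuous_re.comp f.continuous⟩
  have him := hreal ⟨fun y => (f y).im, Complex.continuous_im.comp f.continuous⟩
  have hre' : ∫ y, (f y).re ∂ν = ∫ x, (e.psi ℂ f x).re ∂μ :=
    hre.trans (integral_congr_ae (.of_forall fun x =>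
      (e.psi_map (g := ⟨fun y => (f y).re, _⟩) Complex.reAddGroupHom (fun _ => rfl) x)))
  have him' : ∫ y, (f y).im ∂ν = ∫ x, (e.psi ℂ f x).im ∂μ :=
    him.trans (integral_congr_ae (.of_forall fun x =>
      (e.psi_map (g := ⟨fun y => (f y).im, _⟩) Complex.imAddGroupHom (fun _ => rfl) x)))
  rw [← integral_re_add_im (ContinuousMap.integrable_of_compactSpace ν f),
    ← integral_re_add_im (ContinuousMap.integrable_of_compactSpace μ (e.psi ℂ f))]
  exact congrArg₂ (fun a b : ℝ => (a : ℂ) + b * Complex.I) hre' him'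

/-- The representing measure is invariant because `psi` carries the coboundary of `f` to that of
`f ∘ h`. -/
theorem dualMapsMeasures_invariantMeasures (hA : ConditionI A) (e : ContinuousOrbitEquiv A B) :
    DualMapsMeasures e.psiCLM (invariantMeasures A) (invariantMeasures B) := by
  intro μ hμ
  obtain ⟨ν, hfin, hreg, hν⟩ := e.exists_regular_measure_integral_eq hA hμ
  obtain ⟨hμfin, -, hinv⟩ := hμ
  refine ⟨ν, ⟨hfin, hreg, (shift B).continuous.measurable, ?_⟩, hν, fun ν' _ hν' =>
    measure_ext_of_integral_eq fun f => (hν' f).trans (hν f).symm⟩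
  have : IsFiniteMeasure (ν.map (shift B)) := Measure.isFiniteMeasure_map _ _
  refine measure_ext_of_integral_eq fun f => ?_
  rw [integral_map (shift B).continuous.measurable.aemeasurable
    f.continuous.aestronglyMeasurable]
  have h1 := hν (f - f.comp (shift B))
  simp only [psi_sub_comp_shift] at h1
  replace h1 := h1.trans (integral_coboundary hinv (f.comp ⟨e.h, e.h.continuous⟩))
  have h2 := integral_sub (ContinuousMap.integrable_of_compactSpace ν f)
    (ContinuousMap.integrable_of_compactSpace ν (f.comp (shift B)))
  exact (sub_eq_zero.mp (h2.symm.trans h1)).symm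

theorem psi_one (e : ContinuousOrbitEquiv A B) : e.psi ℤ 1 = e.cocycle := by
  ext x
  simp [psi_apply, birkhoffSum, cocycle]

/-- The total mass of `ν` is `∫ psi 1 ∂μ`, and `psi 1` is the cocycle of `e`, which differs from `1`
by a coboundary. -/
theorem dualMapsMeasures_invariantProbabilityMeasures (hA : ConditionI A)
    (e : ContinuousOrbitEquiv A B) (h : cohomologyClass e.cocycle = cohomologyClass 1) :
    DualMapsMeasures e.psiCLM (invariantProbabilityMeasures A)
      (invariantProbabilityMeasures B) := by
  rintro μ ⟨hμ, hprob⟩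
  obtain ⟨ν, hν, hint, huniq⟩ := e.dualMapsMeasures_invariantMeasures hA μ hμ
  refine ⟨ν, ⟨hν, ?_⟩, hint, huniq⟩
  obtain ⟨ξ, hξ⟩ : e.cocycle - 1 ∈ coboundaries A := by
    have := QuotientAddGroup.eq.mp h.symm
    rwa [neg_add_eq_sub] at this
  have := hν.1
  have h1 := hint (intToComplex 1)
  have hpsi : ∀ x, e.psiCLM (intToComplex 1) x
      = 1 + (intToComplex ξ x - intToComplex ξ (shift A x)) := by
    intro x
    rw [psiCLM_apply, psi_intToComplex, psi_one, ← sub_add_cancel e.cocycle 1, hξ]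
    simp [intToComplex]
    ring
  simp only [hpsi] at h1
  have h3 : ∫ x, ((1 : ℂ) + (intToComplex ξ x - intToComplex ξ (shift A x))) ∂μ = _ :=
    integral_add (integrable_const _) (ContinuousMap.integrable_of_compactSpace μ
      (intToComplex ξ - (intToComplex ξ).comp (shift A)))
  rw [h3, integral_coboundary hμ.2.2] at h1
  have h2 : ∀ y, intToComplex (1 : C(ShiftSpace B, ℤ)) y = 1 := fun y => by simp [intToComplex]
  simp only [h2, integral_const, probReal_univ, one_smul, add_zero,
    Complex.real_smul, mul_one] at h1
  rw [isProbabilityMeasure_iff_real]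
  exact_mod_cast h1

end ContinuousOrbitEquiv

theorem mainTheorem3 {N M : ℕ} (hN : 1 < N) (hM : 1 < M)
    (A : Matrix (Fin N) (Fin N) ℤ) (B : Matrix (Fin M) (Fin M) ℤ)
    (hA01 : ∀ i j, A i j = 0 ∨ A i j = 1) (hB01 : ∀ i j, B i j = 0 ∨ B i j = 1)
    (hAirr : A.IsIrreducible) (hBirr : B.IsIrreducible)
    (hAI : ConditionI A) (hBI : ConditionI B)
    (e : ContinuousOrbitEquiv A B) :
    (e.psi ℤ).comp (e.symm.psi ℤ) = AddMonoidHom.id C(ShiftSpace A, ℤ) ∧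
    (e.symm.psi ℤ).comp (e.psi ℤ) = AddMonoidHom.id C(ShiftSpace B, ℤ) ∧
    ∃ (P : C(ShiftSpace B, ℂ) →L[ℂ] C(ShiftSpace A, ℂ))
      (Q : C(ShiftSpace A, ℂ) →L[ℂ] C(ShiftSpace B, ℂ)),
      (∀ f, P f = e.psi ℂ f) ∧ (∀ g, Q g = e.symm.psi ℂ g) ∧
      (∀ f : C(ShiftSpace B, ℤ), P (intToComplex f) = intToComplex (e.psi ℤ f)) ∧
      (∀ g : C(ShiftSpace A, ℤ), Q (intToComplex g) = intToComplex (e.symm.psi ℤ g)) ∧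
      P.comp Q = ContinuousLinearMap.id ℂ C(ShiftSpace A, ℂ) ∧
      Q.comp P = ContinuousLinearMap.id ℂ C(ShiftSpace B, ℂ) ∧
      DualMapsMeasures P (ShiftSpace.invariantMeasures A) (ShiftSpace.invariantMeasures B) ∧
      DualMapsMeasures Q (ShiftSpace.invariantMeasures B) (ShiftSpace.invariantMeasures A) ∧
      (ShiftSpace.cohomologyClass e.cocycle = ShiftSpace.cohomologyClass 1 →
        DualMapsMeasures P (ShiftSpace.invariantProbabilityMeasures A)
          (ShiftSpace.invariantProbabilityMeasures B)) ∧
      (ShiftSpace.cohomologyClass e.symm.cocycle = ShiftSpace.cohomologyClass 1 →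
        DualMapsMeasures Q (ShiftSpace.invariantProbabilityMeasures B)
          (ShiftSpace.invariantProbabilityMeasures A)) := by
  exact ⟨e.psi_comp_psi_symm hAI, e.psi_symm_comp_psi hBI, e.psiCLM, e.symm.psiCLM,
    fun _ => rfl, fun _ => rfl, e.psi_intToComplex, e.symm.psi_intToComplex,
    ContinuousLinearMap.ext fun g => DFunLike.congr_fun (e.psi_comp_psi_symm hAI) g,
    ContinuousLinearMap.ext fun f => DFunLike.congr_fun (e.psi_symm_comp_psi hBI) f,
    e.dualMapsMeasures_invariantMeasures hAI,
    e.symm.dualMapsMeasures_invariantMeasures hBI,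
    e.dualMapsMeasures_invariantProbabilityMeasures hAI,
    e.symm.dualMapsMeasures_invariantProbabilityMeasures hBI⟩
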